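/- Let $Q_n$ be the $n$-dimensional hypercube, i.e. the graph whose vertices are the binary sequences of length $n$, two of them being adjacent if and only if they differ in exactly one position. A vertex is called even (odd) if it has an even (odd) number of $1$'s. A fault in $Q_n$ is a set $F$ of vertices of $Q_n$; its mass is $|F|$, it is neutral if it contains equally many even and odd vertices, and $Q_n-F$ denotes the subgraph of $Q_n$ induced on the vertices outside $F$. For an even integer $M\ge 0$ let $[M]$ be the smallest positive integer $m$ such that, for every $n\ge m$ and every neutral fault $F$ of mass $M$ in $Q_n$, the graph $Q_n-F$ has a Hamiltonian cycle. Then for every $n\ge 4$ and every neutral fault $F$ of mass $4$ in $Q_n$ (that is, two even and two odd deleted vertices), the graph $Q_n-F$ has a Hamiltonian cycle. The claim fails for $n=3$: there is a neutral fault $F$ of mass $4$ in $Q_3$ such that $Q_3-F$ has no Hamiltonian cycle. Consequently $[4]=4$. -/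

import Mathlib

namespace FaultyCube

/-- The vertices of the `n`-dimensional binary hypercube: binary sequences of length `n`. -/
abbrev Vertex (n : ℕ) : Type := Fin n → Bool

/-- The hypercube `Q_n`: two binary sequences are adjacent if and only if they differ in exactly
one position. -/
def Q (n : ℕ) : SimpleGraph (Vertex n) where
  Adj x y := hammingDist x y = 1
  symm := ⟨fun x y h => by rw [hammingDist_comm]; exact h⟩
  loopless := ⟨fun x h => by simp at h⟩

/-- A vertex is even if it has an even number of `1`s, and odd otherwise. Even vertices play the
role of the red ones, odd vertices that of the green ones. -/
def IsEven {n : ℕ} (x : Vertex n) : Prop :=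
  Even (Finset.univ.filter fun i => x i = true).card

instance {n : ℕ} : DecidablePred (IsEven (n := n)) := fun x =>
  inferInstanceAs (Decidable (Even (Finset.univ.filter fun i => x i = true).card))

/-- A fault in `Q_n` is a set of deleted vertices. -/
abbrev Fault (n : ℕ) : Type := Finset (Vertex n)

/-- The mass of a fault: the number of deleted vertices. -/
def mass {n : ℕ} (F : Fault n) : ℕ := F.card

/-- The charge of a fault: the absolute value of the difference between the numbers of its
vertices of the two parities. -/
def charge {n : ℕ} (F : Fault n) : ℕ :=
  (((F.filter fun x => IsEven x).card : ℤ) - ((F.filter fun x => ¬ IsEven x).card : ℤ)).natAbs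

/-- A fault is neutral if its charge is zero. -/
def IsNeutral {n : ℕ} (F : Fault n) : Prop := charge F = 0

/-- `Q_n - F`: the subgraph of `Q_n` induced on the vertices that are not deleted. -/
def Qminus (n : ℕ) (F : Fault n) : SimpleGraph {x : Vertex n // x ∉ F} :=
  (Q n).induce {x | x ∉ F}

/-- `Q_n - F` is Hamiltonian for every neutral fault `F` of mass `M` in `Q_n`. -/
def HamiltonianForNeutral (M n : ℕ) : Prop :=
  ∀ F : Fault n, IsNeutral F → mass F = M → (Qminus n F).IsHamiltonian

/-- The set `A_M` of positive integers `m` such that, for every `n ≥ m`, the graph `Q_n - F` is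
Hamiltonian for every neutral fault `F` of mass `M` in `Q_n`. Its least element is `[M]`. -/
def A (M : ℕ) : Set ℕ := {m | 0 < m ∧ ∀ n, m ≤ n → HamiltonianForNeutral M n}

end FaultyCube

namespace FaultyCube

/-! Let r₁, r₂ be the deleted vertices of one parity and g₁, g₂ those of the other. Split the cube
into halves along a coordinate `i`; Hamiltonian paths of the two halves with corresponding ends
close up through two edges of direction `i`.

If some `i` separates the r's but not the g's, one half loses three vertices and the other loses
one. The first has a Hamiltonian path with ends of equal parity (`exists_hamPath_compl_triple`), and
the second has one between any two vertices of the parity opposite to its deleted vertex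
(`hamPath_compl_singleton`), so the ends can be matched.

Otherwise every coordinate separating the r's separates the g's. There are at least two, `i` and
`j`, because r₁ and r₂ have equal parity. Each half along `i` loses one vertex of each parity, and
splitting it along `j` gives enough control over the ends to match them. -/

/-- The vertices of `S` can be listed without repetition, consecutive ones being adjacent in `G`,
starting at `a` and ending at `b`. -/
def HamPath {V : Type*} (G : SimpleGraph V) (S : Set V) (a b : V) : Prop :=
  ∃ l : List V, l.Nodup ∧ (∀ x, x ∈ l ↔ x ∈ S) ∧ l.IsChain G.Adj ∧
    l.head? = some a ∧ l.getLast? = some b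

/-! ### Hamiltonian paths on vertex sets -/

section HamPath

variable {V W : Type*} {G : SimpleGraph V} {H : SimpleGraph W} {S T : Set V} {a b c d : V}

theorem HamPath.symm (h : HamPath G S a b) : HamPath G S b a := by
  obtain ⟨l, hn, hm, hc, ha, hb⟩ := h
  refine ⟨l.reverse, by simpa, by simpa, ?_, by simpa, by simpa⟩
  rw [List.isChain_reverse]
  exact hc.imp fun x y hxy => hxy.symm

theorem hamPath_singleton (a : V) : HamPath G {a} a a :=
  ⟨[a], by simp, by simp, by simp, by simp, by simp⟩

theorem HamPath.append (h : HamPath G S a b) (h' : HamPath G T c d) (hd : Disjoint S T)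
    (hbc : G.Adj b c) : HamPath G (S ∪ T) a d := by
  obtain ⟨l, hn, hm, hc, ha, hb⟩ := h
  obtain ⟨l', hn', hm', hc', ha', hb'⟩ := h'
  refine ⟨l ++ l', ?_, by simp [hm, hm'], ?_, ?_, ?_⟩
  · rw [List.nodup_append']
    refine ⟨hn, hn', fun x hx hx' => ?_⟩
    exact Set.disjoint_left.1 hd ((hm x).1 hx) ((hm' x).1 hx')
  · rw [List.isChain_append]
    refine ⟨hc, hc', ?_⟩
    rw [hb, ha']
    simpa using hbc
  · simp [List.head?_append, ha]
  · simp [List.getLast?_append, hb']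

theorem HamPath.map (h : HamPath G S a b) (f : V → W) (hf : Function.Injective f)
    (hadj : ∀ x y, G.Adj x y → H.Adj (f x) (f y)) : HamPath H (f '' S) (f a) (f b) := by
  obtain ⟨l, hn, hm, hc, ha, hb⟩ := h
  refine ⟨l.map f, hn.map hf, by simp [hm], List.isChain_map_of_isChain f hadj hc, ?_, ?_⟩
  · simp [ha]
  · simp [hb]

/-- A path visits `a` only once, so an edge of it at `a` is its first edge. If that edge led to `b`,
the path would stop there and leave no room for `y`. -/
theorem closing_edge_notMem_edges {w : G.Walk a b} (hw : w.IsPath) {y : V} (hy : y ∈ w.support)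
    (hya : y ≠ a) (hyb : y ≠ b) : s(b, a) ∉ w.edges := by
  intro he
  cases w with
  | nil => simp at he
  | cons hv q =>
    rw [SimpleGraph.Walk.cons_isPath_iff] at hw
    rw [SimpleGraph.Walk.edges_cons, List.mem_cons] at he
    rcases he with he | he
    · rw [Sym2.eq_swap, Sym2.congr_right] at he
      subst he
      rw [(SimpleGraph.Walk.isPath_iff_nil.1 hw.1).eq_nil] at hy
      simp at hy
      tauto
    · exact hw.2 (q.snd_mem_support_of_mem_edges he)

/-- A Hamiltonian path of length at least two whose ends are adjacent closes up to a Hamiltonian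
cycle of the subgraph induced on its vertices. -/
theorem HamPath.exists_isHamiltonianCycle [DecidableEq V] (p : V → Prop)
    (h : HamPath G {x | p x} a b) (hab : G.Adj b a) (hcard : ∃ x, p x ∧ x ≠ a ∧ x ≠ b) :
    ∃ (v : {x // p x}) (w : (G.induce {x | p x}).Walk v v), w.IsHamiltonianCycle := by
  obtain ⟨l, hn, hm, hc, ha, hb⟩ := h
  have hl : ∀ x ∈ l, p x := fun x hx => (hm x).1 hx
  have hne : l ≠ [] := by rintro rfl; simp at ha
  obtain ⟨l', rfl⟩ : ∃ l' : List {x // p x}, l'.map Subtype.val = l :=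
    ⟨l.attach.map fun x => ⟨x.1, hl _ x.2⟩, by simp [List.map_map, Function.comp_def]⟩
  have hne' : l' ≠ [] := fun h => hne (by rw [h]; rfl)
  have hc' : l'.IsChain (G.induce {x | p x}).Adj := by
    rw [List.isChain_map] at hc
    exact hc
  let w := SimpleGraph.Walk.ofSupport l' hne' hc'
  have hw : w.support = l' := SimpleGraph.Walk.support_ofSupport hne' hc'
  have hpath : w.IsPath := by
    rw [SimpleGraph.Walk.isPath_def, hw]
    exact hn.of_map
  have hham : w.IsHamiltonian := hpath.isHamiltonian_of_mem fun x => by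
    rw [hw]
    have := (hm x.1).2 x.2
    rw [List.mem_map] at this
    obtain ⟨y, hy, hyx⟩ := this
    rwa [← Subtype.ext hyx]
  have ha' : (l'.head hne').1 = a := by
    rw [List.head?_map, List.head?_eq_some_head hne'] at ha
    simpa using ha
  have hb' : (l'.getLast hne').1 = b := by
    rw [List.getLast?_map, List.getLast?_eq_some_getLast hne'] at hb
    simpa using hb
  have hadj : (G.induce {x | p x}).Adj (l'.getLast hne') (l'.head hne') := by
    simpa [ha', hb'] using hab
  refine ⟨_, SimpleGraph.Walk.cons hadj w, ?_⟩
  rw [SimpleGraph.Walk.isHamiltonianCycle_isCycle_and_isHamiltonian_tail]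
  refine ⟨(SimpleGraph.Walk.cons_isCycle_iff _ _).2 ⟨hpath, fun he => ?_⟩, by
    simpa [SimpleGraph.Walk.IsHamiltonian] using hham⟩
  obtain ⟨x, hx, hxa, hxb⟩ := hcard
  have hxw : (⟨x, hx⟩ : {x // p x}) ∈ w.support := hham.mem_support _
  have hxa' : (⟨x, hx⟩ : {x // p x}) ≠ l'.head hne' := fun h => hxa (by rw [← ha', ← h])
  have hxb' : (⟨x, hx⟩ : {x // p x}) ≠ l'.getLast hne' := fun h => hxb (by rw [← hb', ← h])
  exact closing_edge_notMem_edges hpath hxw hxa' hxb' he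

end HamPath

/-! ### Opposite faces and parity -/

/-- The number of ones of a vertex, modulo two. -/
def par {n : ℕ} (x : Vertex n) : Bool := decide (¬ IsEven x)

/-- The embedding of `Q n` into `Q (n + 1)` as the face on which the `i`-th coordinate is `b`. -/
abbrev face {n : ℕ} (i : Fin (n + 1)) (b : Bool) (x : Vertex n) : Vertex (n + 1) :=
  i.insertNth (α := fun _ => Bool) b x

variable {n : ℕ}

theorem exists_eq_face (i : Fin (n + 1)) (x : Vertex (n + 1)) : ∃ y, x = face i (x i) y :=
  ⟨i.removeNth x, (Fin.insertNth_self_removeNth (α := fun _ => Bool) i x).symm⟩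

theorem face_inj {i : Fin (n + 1)} {b c : Bool} {x y : Vertex n} :
    face i b x = face i c y ↔ b = c ∧ x = y :=
  Fin.insertNth_inj (α := fun _ => Bool)

theorem isEven_face (i : Fin (n + 1)) (b : Bool) (x : Vertex n) :
    IsEven (face i b x) ↔ (b = true ↔ ¬ IsEven x) := by
  unfold IsEven
  rw [Finset.card_filter, Finset.card_filter, Fin.sum_univ_succAbove _ i]
  simp only [face, Fin.insertNth_apply_same, Fin.insertNth_apply_succAbove]
  cases b <;> simp [Nat.even_add_one, add_comm 1]

theorem par_face (i : Fin (n + 1)) (b : Bool) (x : Vertex n) :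
    par (face i b x) = (b ^^ par x) := by
  unfold par
  by_cases h : IsEven x <;> cases b <;> simp [isEven_face, h]

theorem hammingDist_face (i : Fin (n + 1)) (b c : Bool) (x y : Vertex n) :
    hammingDist (face i b x) (face i c y) = (if b ≠ c then 1 else 0) + hammingDist x y := by
  unfold hammingDist
  rw [Finset.card_filter, Finset.card_filter, Fin.sum_univ_succAbove _ i]
  simp only [face, Fin.insertNth_apply_same, Fin.insertNth_apply_succAbove]

theorem adj_face {i : Fin (n + 1)} {b : Bool} {x y : Vertex n} (h : (Q n).Adj x y) :
    (Q (n + 1)).Adj (face i b x) (face i b y) := by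
  change hammingDist _ _ = 1
  rw [hammingDist_face]
  simpa using (show hammingDist x y = 1 from h)

theorem adj_face_not (i : Fin (n + 1)) (b : Bool) (x : Vertex n) :
    (Q (n + 1)).Adj (face i b x) (face i (!b) x) := by
  change hammingDist _ _ = 1
  rw [hammingDist_face]
  simp

/-- Hamiltonian paths of two opposite faces, the second starting above the end of the first,
combine to a Hamiltonian path. -/
theorem HamPath.join {S T : Set (Vertex n)} {a b c : Vertex n} (h : HamPath (Q n) S a b)
    (h' : HamPath (Q n) T b c) (i : Fin (n + 1)) (v : Bool) {U : Set (Vertex (n + 1))}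
    (hS : ∀ x, face i v x ∈ U ↔ x ∈ S) (hT : ∀ x, face i (!v) x ∈ U ↔ x ∈ T) :
    HamPath (Q (n + 1)) U (face i v a) (face i (!v) c) := by
  have inj : ∀ w, Function.Injective (face i w) := fun w x y hxy => (face_inj.1 hxy).2
  have hU : U = face i v '' S ∪ face i (!v) '' T := by
    ext x
    obtain ⟨y, hy⟩ := exists_eq_face i x
    rw [hy]
    cases v <;> cases x i <;> simp_all
  rw [hU]
  refine (h.map (face i v) (inj _) fun _ _ => adj_face).append
    (h'.map (face i (!v)) (inj _) fun _ _ => adj_face) ?_ (adj_face_not i v b)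
  rw [Set.disjoint_left]
  rintro _ ⟨x, -, rfl⟩ ⟨y, -, hy⟩
  simpa using (face_inj.1 hy).1

theorem par_face_eq_par_face {i : Fin (n + 1)} {v : Bool} {x y : Vertex n} :
    par (face i v x) = par (face i v y) ↔ par x = par y := by
  rw [par_face, par_face]
  exact Bool.xor_right_inj

theorem par_face_eq_par_face_not {i : Fin (n + 1)} {v : Bool} {x y : Vertex n} :
    par (face i v x) = par (face i (!v) y) ↔ par x ≠ par y := by
  rw [par_face, par_face]
  cases v <;> cases par x <;> cases par y <;> decide

theorem par_face_not_eq_par_face {i : Fin (n + 1)} {v : Bool} {x y : Vertex n} :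
    par (face i (!v) x) = par (face i v y) ↔ par x ≠ par y := by
  rw [par_face, par_face]
  cases v <;> cases par x <;> cases par y <;> decide

theorem face_apply (i : Fin (n + 1)) (v : Bool) (x : Vertex n) : face i v x i = v :=
  Fin.insertNth_apply_same (α := fun _ => Bool) i v x

theorem face_apply_succAbove (i : Fin (n + 1)) (v : Bool) (x : Vertex n) (j : Fin n) :
    face i v x (i.succAbove j) = x j :=
  Fin.insertNth_apply_succAbove (α := fun _ => Bool) i v x j

theorem eq_face_of_apply {i : Fin (n + 1)} {v : Bool} {x : Vertex (n + 1)} (h : x i = v) :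
    ∃ y, x = face i v y :=
  h ▸ exists_eq_face i x

theorem exists_par_eq (hn : 1 ≤ n) (p : Bool) : ∃ x : Vertex n, par x = p := by
  obtain ⟨m, rfl⟩ : ∃ m, n = m + 1 := ⟨n - 1, by omega⟩
  let z : Vertex m := fun _ => false
  exact ⟨face 0 (p ^^ par z) z, by rw [par_face]; simp⟩

theorem exists_ne_par_eq (hn : 2 ≤ n) (x : Vertex n) : ∃ y, y ≠ x ∧ par y = par x := by
  obtain ⟨m, rfl⟩ : ∃ m, n = m + 1 := ⟨n - 1, by omega⟩
  obtain ⟨x', hx⟩ := exists_eq_face 0 x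
  obtain ⟨z, hz⟩ := exists_par_eq (n := m) (by omega) (!par x')
  refine ⟨face 0 (!x 0) z, fun h => ?_, ?_⟩
  · have h0 := congrFun h 0
    simp at h0
  · rw [hx, par_face, par_face, hz]
    simp

theorem exists_apply_eq_not {x y : Vertex n} (h : x ≠ y) : ∃ i, y i = !x i := by
  obtain ⟨i, hi⟩ := Function.ne_iff.1 h
  exact ⟨i, Bool.eq_not.2 hi.symm⟩

/-! ### Hamiltonian paths after at most three deletions -/

/-- In a hypercube any two vertices of different parity are joined by a Hamiltonian path. -/
theorem hamPath_univ (a b : Vertex n) (h : par a ≠ par b) : HamPath (Q n) Set.univ a b := by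
  induction n with
  | zero => exact absurd (congrArg par (Subsingleton.elim a b)) h
  | succ n ih =>
    obtain ⟨i, hi⟩ := exists_apply_eq_not fun hab => h (congrArg par hab)
    obtain ⟨a', ha⟩ := exists_eq_face i a
    obtain ⟨b', hb⟩ := eq_face_of_apply hi
    have hab : par a' = par b' := by
      rwa [ha, hb, Ne, par_face_eq_par_face_not, not_not] at h
    obtain ⟨c, hac, hcb⟩ : ∃ c, HamPath (Q n) Set.univ a' c ∧ HamPath (Q n) Set.univ c b' := by
      rcases Nat.eq_zero_or_pos n with rfl | hn
      · have huniv : (Set.univ : Set (Vertex 0)) = {a'} := Set.eq_singleton_iff_unique_mem.2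
          ⟨trivial, fun x _ => Subsingleton.elim x a'⟩
        rw [huniv, Subsingleton.elim b' a']
        exact ⟨a', hamPath_singleton _, hamPath_singleton _⟩
      · obtain ⟨c, hc⟩ := exists_par_eq hn (!par a')
        exact ⟨c, ih _ _ (by simp [hc]), ih _ _ (by simp [hc, hab])⟩
    rw [ha, hb]
    exact hac.join hcb i (a i) (by simp) (by simp)

/-- The assumption `H` lets this serve inside the induction for `hamPath_compl_singleton`. In
dimension one the path is the single vertex `x`, so `y = x` has to be allowed. -/
theorem exists_hamPath_compl_singleton_of_forall
    (H : ∀ r a b : Vertex n, a ≠ b → par a = par b → par r ≠ par a → HamPath (Q n) {r}ᶜ a b)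
    (hn : 1 ≤ n) (x : Vertex n) :
    ∃ y, par y = par x ∧ ∀ r, par r ≠ par x → HamPath (Q n) {r}ᶜ x y := by
  obtain rfl | hn := hn.eq_or_lt
  · refine ⟨x, rfl, fun r hr => ?_⟩
    have key : ∀ r x y : Vertex 1, par r ≠ par x → (y ≠ r ↔ y = x) := by decide
    have hx : ({r}ᶜ : Set (Vertex 1)) = {x} := Set.ext fun y => key r x y hr
    rw [hx]
    exact hamPath_singleton x
  · obtain ⟨y, hne, hy⟩ := exists_ne_par_eq hn x
    exact ⟨y, hy, fun r hr => H r x y hne.symm hy.symm hr⟩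

/-- After deletion of one vertex any two vertices of the other parity are joined by a Hamiltonian
path. -/
theorem hamPath_compl_singleton (r a b : Vertex n) (hab : a ≠ b) (hp : par a = par b)
    (hr : par r ≠ par a) : HamPath (Q n) {r}ᶜ a b := by
  induction n with
  | zero => exact absurd (Subsingleton.elim a b) hab
  | succ n ih =>
    obtain ⟨i, hi⟩ := exists_apply_eq_not hab
    wlog hri : r i = a i generalizing a b
    · refine (this b a hab.symm hp.symm (hp ▸ hr) (by simp [hi]) ?_).symm
      rw [hi]
      exact Bool.eq_not.2 hri
    obtain ⟨a', ha⟩ := exists_eq_face i a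
    obtain ⟨b', hb⟩ := eq_face_of_apply hi
    obtain ⟨r', hr'⟩ := eq_face_of_apply hri
    generalize a i = v at *
    subst ha hb hr'
    rw [par_face_eq_par_face_not] at hp
    rw [Ne, par_face_eq_par_face] at hr
    have hn : 1 ≤ n := Nat.one_le_iff_ne_zero.2 fun hn => by
      subst hn
      exact hr (congrArg par (Subsingleton.elim r' a'))
    obtain ⟨c, hc, hac⟩ := exists_hamPath_compl_singleton_of_forall ih hn a'
    exact (hac r' hr).join (hamPath_univ c b' (hc ▸ hp)) i v (by simp) (by simp)

/-- Every vertex `x` is the start of Hamiltonian paths with a common end, whichever vertex of the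
other parity is deleted. -/
theorem exists_hamPath_compl_singleton (hn : 1 ≤ n) (x : Vertex n) :
    ∃ y, par y = par x ∧ ∀ r, par r ≠ par x → HamPath (Q n) {r}ᶜ x y :=
  exists_hamPath_compl_singleton_of_forall hamPath_compl_singleton hn x

/-- If the two deleted vertices are separated by the coordinate `j`, then there is a Hamiltonian
path between the ends of any edge of direction `j` whose end on the side of `r` has the parity
of `g`. -/
theorem hamPath_compl_pair_of_apply_ne (hn : 1 ≤ n) {r g : Vertex (n + 1)} {j : Fin (n + 1)}
    (hj : g j = !r j) (hp : par r ≠ par g) (x : Vertex n) (hx : par (face j (r j) x) = par g) :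
    HamPath (Q (n + 1)) {r, g}ᶜ (face j (r j) x) (face j (!r j) x) := by
  obtain ⟨r', hr⟩ := exists_eq_face j r
  obtain ⟨g', hg⟩ := eq_face_of_apply hj
  generalize r j = v at *
  subst hr hg
  rw [Ne, par_face_eq_par_face_not, not_not] at hp
  rw [par_face_eq_par_face_not] at hx
  obtain ⟨y, -, hxy⟩ := exists_hamPath_compl_singleton hn x
  exact (hxy r' (hp ▸ hx.symm)).join (hxy g' hx.symm).symm j v (by simp) (by simp)

/-- After deletion of two vertices of different parity there is a Hamiltonian path. -/
theorem exists_hamPath_compl_pair (hn : 2 ≤ n) (r g : Vertex n) (hp : par r ≠ par g) :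
    ∃ x y, par x = par r ∧ par y = par g ∧ HamPath (Q n) {r, g}ᶜ x y := by
  obtain ⟨m, rfl⟩ : ∃ m, n = m + 1 := ⟨n - 1, by omega⟩
  obtain ⟨j, hj⟩ := exists_apply_eq_not fun h => hp (congrArg par h)
  obtain ⟨x, hx⟩ := exists_par_eq (n := m) (by omega) (r j ^^ par g)
  have hx' : par (face j (r j) x) = par g := by rw [par_face, hx]; simp
  refine ⟨face j (!r j) x, face j (r j) x, ?_, hx',
    (hamPath_compl_pair_of_apply_ne (by omega) hj hp x hx').symm⟩
  rw [par_face, hx, Bool.eq_not.2 hp]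
  simp

/-- If the two deleted vertices agree at the coordinate `j`, then there is a vertex on their side,
of prescribed parity, joined by Hamiltonian paths to all vertices of the other parity on the other
side. -/
theorem exists_hamPath_compl_pair_of_apply_eq (hn : 2 ≤ n) {r g : Vertex (n + 1)}
    {j : Fin (n + 1)} (hj : g j = r j) (hp : par r ≠ par g) (p : Bool) :
    ∃ a, a j = r j ∧ par a = p ∧
      ∀ c, c j = !r j → par c ≠ p → HamPath (Q (n + 1)) {r, g}ᶜ a c := by
  obtain ⟨r', hr⟩ := exists_eq_face j r
  obtain ⟨g', hg⟩ := eq_face_of_apply hj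
  generalize r j = v at *
  subst hr hg
  rw [Ne, par_face_eq_par_face] at hp
  -- The ends of the path have opposite parities, so reversing it if necessary gives the start the
  -- prescribed one.
  obtain ⟨x, y, hx, hxy, h⟩ :
      ∃ x y, par (face j v x) = p ∧ par y ≠ par x ∧ HamPath (Q n) {r', g'}ᶜ x y := by
    obtain ⟨x, y, hx, hy, h⟩ := exists_hamPath_compl_pair hn r' g' hp
    have hxy : par x ≠ par y := by rwa [hx, hy]
    by_cases hxp : par (face j v x) = p
    · exact ⟨x, y, hxp, hxy.symm, h⟩
    · refine ⟨y, x, ?_, hxy, h.symm⟩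
      rw [par_face] at hxp ⊢
      rw [Bool.eq_not.2 hxy] at hxp
      simpa using hxp
  refine ⟨face j v x, face_apply _ _ _, hx, fun c hc hcp => ?_⟩
  obtain ⟨c', rfl⟩ := eq_face_of_apply hc
  rw [← hx, Ne, par_face_not_eq_par_face, not_not] at hcp
  exact h.join (hamPath_univ y c' (hcp ▸ hxy)) j v (by simp) (by simp)

/-- After deletion of three vertices, not all of the same parity, there is a Hamiltonian path. -/
theorem exists_hamPath_compl_triple (hn : 3 ≤ n) (r g₁ g₂ : Vertex n) (hg : g₁ ≠ g₂)
    (hpg : par g₁ = par g₂) (hp : par r ≠ par g₁) :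
    ∃ a b, a ≠ b ∧ par a = par r ∧ par b = par r ∧ HamPath (Q n) {r, g₁, g₂}ᶜ a b := by
  obtain ⟨m, rfl⟩ : ∃ m, n = m + 1 := ⟨n - 1, by omega⟩
  obtain ⟨i, hi⟩ := exists_apply_eq_not hg
  wlog hri : r i = g₁ i generalizing g₁ g₂
  · rw [Set.pair_comm g₁ g₂]
    exact this g₂ g₁ hg.symm hpg.symm (hpg ▸ hp) (by simp [hi]) (hi ▸ Bool.eq_not.2 hri)
  obtain ⟨g₁', h₁⟩ := exists_eq_face i g₁
  obtain ⟨g₂', h₂⟩ := eq_face_of_apply hi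
  obtain ⟨r', hr⟩ := eq_face_of_apply hri
  generalize g₁ i = v at *
  subst h₁ h₂ hr
  rw [par_face_eq_par_face_not] at hpg
  rw [Ne, par_face_eq_par_face] at hp
  obtain ⟨x, y, hx, hy, hxy⟩ := exists_hamPath_compl_pair (by omega) r' g₁' hp
  obtain ⟨z, hz, hyz⟩ := exists_hamPath_compl_singleton (by omega) y
  refine ⟨face i v x, face i (!v) z, by simp, par_face_eq_par_face.2 hx,
    par_face_not_eq_par_face.2 ?_, hxy.join (hyz g₂' ?_) i v (by simp) (by simp)⟩
  · rw [hz, hy]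
    exact Ne.symm hp
  · rw [hy]
    exact hpg.symm

/-! ### Hamiltonian cycles after four deletions -/

/-- A Hamiltonian path on `S` whose ends are adjacent. -/
def HamCycle {V : Type*} (G : SimpleGraph V) (S : Set V) : Prop :=
  ∃ a b, HamPath G S a b ∧ G.Adj b a

/-- Hamiltonian paths of two opposite faces with the same ends combine to a Hamiltonian cycle. -/
theorem HamPath.hamCycle {S T : Set (Vertex n)} {a b : Vertex n} (h : HamPath (Q n) S a b)
    (h' : HamPath (Q n) T a b) (i : Fin (n + 1)) (v : Bool) {U : Set (Vertex (n + 1))}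
    (hS : ∀ x, face i v x ∈ U ↔ x ∈ S) (hT : ∀ x, face i (!v) x ∈ U ↔ x ∈ T) :
    HamCycle (Q (n + 1)) U :=
  ⟨_, _, h.join h'.symm i v hS hT, (adj_face_not i v a).symm⟩

theorem hamCycle_of_apply_eq (hn : 3 ≤ n) {r₁ r₂ g₁ g₂ : Vertex (n + 1)} (hg : g₁ ≠ g₂)
    (hpr : par r₁ = par r₂) (hpg : par g₁ = par g₂) (hp : par r₁ ≠ par g₁) {i : Fin (n + 1)}
    (hri : r₂ i = !r₁ i) (hgi : g₂ i = g₁ i) : HamCycle (Q (n + 1)) {r₁, r₂, g₁, g₂}ᶜ := by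
  wlog h : g₁ i = r₁ i generalizing r₁ r₂
  · rw [Set.insert_comm]
    exact this hpr.symm (hpr ▸ hp) (by simp [hri]) (hri ▸ Bool.eq_not.2 h)
  obtain ⟨r₁', h₁⟩ := exists_eq_face i r₁
  obtain ⟨r₂', h₂⟩ := eq_face_of_apply hri
  obtain ⟨g₁', h₃⟩ := eq_face_of_apply h
  obtain ⟨g₂', h₄⟩ := eq_face_of_apply (hgi.trans h)
  generalize r₁ i = v at *
  subst h₁ h₂ h₃ h₄
  rw [par_face_eq_par_face_not] at hpr
  rw [par_face_eq_par_face] at hpg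
  rw [Ne, par_face_eq_par_face] at hp
  obtain ⟨a, b, hab, ha, hb, H⟩ :=
    exists_hamPath_compl_triple hn r₁' g₁' g₂' (fun h => hg (by rw [h])) hpg hp
  exact H.hamCycle (hamPath_compl_singleton r₂' a b hab (ha.trans hb.symm) (ha ▸ hpr.symm)) i v
    (by simp) (by simp)

theorem hamCycle_of_apply_ne (hn : 2 ≤ n) {r₁ r₂ g₁ g₂ : Vertex (n + 2)}
    (hpr : par r₁ = par r₂) (hpg : par g₁ = par g₂) (hp : par r₁ ≠ par g₁) {i j : Fin (n + 2)}
    (hij : j ≠ i) (hri : r₂ i = !r₁ i) (hgi : g₂ i = !g₁ i) (hrj : r₂ j = !r₁ j)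
    (hgj : g₂ j = !g₁ j) : HamCycle (Q (n + 2)) {r₁, r₂, g₁, g₂}ᶜ := by
  wlog h : g₁ i = r₁ i generalizing g₁ g₂
  · rw [Set.pair_comm g₁ g₂]
    refine this hpg.symm (hpg ▸ hp) (by simp [hgi]) (by simp [hgj]) ?_
    rw [hgi, Bool.eq_not.2 h, Bool.not_not]
  obtain ⟨j, rfl⟩ := Fin.exists_succAbove_eq hij
  obtain ⟨r₁', h₁⟩ := exists_eq_face i r₁
  obtain ⟨r₂', h₂⟩ := eq_face_of_apply hri
  obtain ⟨g₁', h₃⟩ := eq_face_of_apply h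
  obtain ⟨g₂', h₄⟩ := eq_face_of_apply (hgi.trans (congrArg _ h))
  generalize r₁ i = v at *
  subst h₁ h₂ h₃ h₄
  rw [par_face_eq_par_face_not] at hpr hpg
  rw [Ne, par_face_eq_par_face] at hp
  rw [face_apply_succAbove, face_apply_succAbove] at hrj hgj
  have hp' : par r₂' ≠ par g₂' := by
    rw [Bool.eq_not.2 hpr.symm, Bool.eq_not.2 hpg.symm]
    simpa using hp
  by_cases hj : g₁' j = r₁' j
  · obtain ⟨a, haj, hap, ha⟩ := exists_hamPath_compl_pair_of_apply_eq hn hj hp true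
    obtain ⟨c, hcj, hcp, hc⟩ :=
      exists_hamPath_compl_pair_of_apply_eq hn (by rw [hrj, hgj, hj]) hp' false
    exact (ha c (hcj.trans hrj) (by simp [hcp])).hamCycle
      (hc a (by simp [haj, hrj]) (by simp [hap])).symm i v (by simp) (by simp)
  · have hj : g₁' j = !r₁' j := Bool.eq_not.2 hj
    obtain ⟨x, hx⟩ := exists_par_eq (n := n) (by omega) (r₁' j ^^ par g₁')
    have hx₁ : par (face j (r₁' j) x) = par g₁' := by rw [par_face, hx]; simp
    have hg₂ : g₂' j = r₁' j := by rw [hgj, hj, Bool.not_not]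
    have hx₂ : par (face j (g₂' j) x) = par r₂' := by
      rw [hg₂, hx₁, Bool.eq_not.2 hpr.symm, Bool.eq_not.2 hp, Bool.not_not]
    have H := hamPath_compl_pair_of_apply_ne (by omega) (hrj.trans (by rw [hg₂])) hp'.symm x hx₂
    rw [hg₂, Set.pair_comm] at H
    exact (hamPath_compl_pair_of_apply_ne (by omega) hj hp x hx₁).hamCycle H i v
      (by simp) (by simp)

/-- In dimension at least four there is a Hamiltonian cycle after deletion of two vertices of each
parity. -/
theorem hamCycle_compl (hn : 4 ≤ n) {r₁ r₂ g₁ g₂ : Vertex n} (hr : r₁ ≠ r₂) (hg : g₁ ≠ g₂)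
    (hpr : par r₁ = par r₂) (hpg : par g₁ = par g₂) (hp : par r₁ ≠ par g₁) :
    HamCycle (Q n) {r₁, r₂, g₁, g₂}ᶜ := by
  obtain ⟨m, rfl⟩ : ∃ m, n = m + 2 := ⟨n - 2, by omega⟩
  by_cases h₁ : ∃ i, r₂ i = !r₁ i ∧ g₂ i = g₁ i
  · obtain ⟨i, hri, hgi⟩ := h₁
    exact hamCycle_of_apply_eq (by omega) hg hpr hpg hp hri hgi
  have hrg : ∀ i, r₂ i = !r₁ i → g₂ i = !g₁ i := fun i hi =>
    Bool.eq_not.2 fun h => h₁ ⟨i, hi, h⟩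
  obtain ⟨i, hi⟩ := exists_apply_eq_not hr
  -- Vertices of equal parity cannot differ in `i` alone.
  obtain ⟨j, hij, hj⟩ : ∃ j, j ≠ i ∧ r₂ j = !r₁ j := by
    obtain ⟨r₁', h₁⟩ := exists_eq_face i r₁
    obtain ⟨r₂', h₂⟩ := eq_face_of_apply hi
    rw [h₁, h₂, par_face_eq_par_face_not] at hpr
    obtain ⟨j, hj⟩ := exists_apply_eq_not fun h => hpr (congrArg par h)
    refine ⟨i.succAbove j, Fin.succAbove_ne i j, ?_⟩
    rw [h₁, h₂, face_apply_succAbove, face_apply_succAbove, hj]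
  exact hamCycle_of_apply_ne (by omega) hpr hpg hp hij hi (hrg i hi) hj (hrg j hj)

theorem qminus_isHamiltonian (hn : 4 ≤ n) (F : Fault n) (hF : IsNeutral F) (hm : mass F = 4) :
    (Qminus n F).IsHamiltonian := by
  -- `IsHamiltonian` demands a cycle only if the number of vertices is not one.
  intro _
  have hcard := Finset.card_filter_add_card_filter_not (s := F) (fun x => IsEven x)
  unfold mass at hm
  unfold IsNeutral charge at hF
  obtain ⟨r₁, r₂, hr, hrF⟩ :=
    Finset.card_eq_two.1 (show (F.filter fun x => IsEven x).card = 2 by omega)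
  obtain ⟨g₁, g₂, hg, hgF⟩ :=
    Finset.card_eq_two.1 (show (F.filter fun x => ¬ IsEven x).card = 2 by omega)
  have hpr : ∀ x ∈ ({r₁, r₂} : Finset (Vertex n)), par x = false := fun x hx => by
    rw [← hrF, Finset.mem_filter] at hx
    simpa [par] using hx.2
  have hpg : ∀ x ∈ ({g₁, g₂} : Finset (Vertex n)), par x = true := fun x hx => by
    rw [← hgF, Finset.mem_filter] at hx
    simpa [par] using hx.2
  have hF' : F = {r₁, r₂, g₁, g₂} := by
    rw [← Finset.filter_union_filter_not_eq (fun x => IsEven x) F, hrF, hgF]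
    ext x
    simp only [Finset.mem_union, Finset.mem_insert, Finset.mem_singleton, or_assoc]
  have h₁ := hpr r₁ (by simp)
  have h₂ := hpr r₂ (by simp)
  have h₃ := hpg g₁ (by simp)
  have h₄ := hpg g₂ (by simp)
  obtain ⟨a, b, hab, hadj⟩ := hamCycle_compl hn hr hg (h₁.trans h₂.symm) (h₃.trans h₄.symm)
    (by rw [h₁, h₃]; decide)
  have hset : ({r₁, r₂, g₁, g₂}ᶜ : Set (Vertex n)) = {x | x ∉ F} := by
    ext x
    simp [hF']
  rw [hset] at hab
  refine hab.exists_isHamiltonianCycle (fun x => x ∉ F) hadj ?_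
  -- The third vertex needed for closing the path exists since 4 + 2 < 2 ^ 4.
  obtain ⟨x, hx⟩ : ∃ x, x ∉ F ∪ {a, b} := by
    by_contra! hall
    have h6 : (F ∪ {a, b}).card ≤ 6 :=
      (Finset.card_union_le _ _).trans (by rw [hm]; exact Nat.add_le_add_left Finset.card_le_two 4)
    rw [Finset.eq_univ_of_forall hall, Finset.card_univ] at h6
    simp only [Fintype.card_pi, Fintype.card_bool, Finset.prod_const, Finset.card_univ,
      Fintype.card_fin] at h6
    have := Nat.pow_le_pow_right (show 0 < 2 by decide) hn
    omega
  exact ⟨x, by simp_all, by simp_all, by simp_all⟩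

/-! ### The counterexample in dimension three -/

/-- Deleting these vertices from the three-dimensional cube leaves two disjoint edges. -/
def cubeFault : Fault 3 :=
  {![false, true, false], ![true, false, false], ![true, false, true], ![false, true, true]}

theorem not_qminus_cubeFault_isHamiltonian : ¬ (Qminus 3 cubeFault).IsHamiltonian := by
  intro h
  have hadj : ∀ x y : Vertex 3, x ∉ cubeFault → y ∉ cubeFault → hammingDist x y = 1 →
      x 0 = y 0 := by decide
  have hreach : ∀ x y : {x // x ∉ cubeFault}, (Qminus 3 cubeFault).Walk x y → x.1 0 = y.1 0 := by
    intro x y w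
    induction w with
    | nil => rfl
    | @cons u v _ huv _ ih => exact (hadj u.1 v.1 u.2 v.2 huv).trans ih
  obtain ⟨w⟩ := h.connected.preconnected ⟨![false, false, false], by decide⟩
    ⟨![true, true, true], by decide⟩
  simpa using hreach _ _ w

end FaultyCube

theorem mainTheorem1 :
    (∀ (n : ℕ), 4 ≤ n → ∀ F : FaultyCube.Fault n,
      FaultyCube.IsNeutral F → FaultyCube.mass F = 4 → (FaultyCube.Qminus n F).IsHamiltonian) ∧
    (∃ F : FaultyCube.Fault 3,
      FaultyCube.IsNeutral F ∧ FaultyCube.mass F = 4 ∧ ¬ (FaultyCube.Qminus 3 F).IsHamiltonian) ∧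
    IsLeast (FaultyCube.A 4) 4 := by
  have hneutral : FaultyCube.IsNeutral FaultyCube.cubeFault := by
    unfold FaultyCube.IsNeutral
    decide
  have hmass : FaultyCube.mass FaultyCube.cubeFault = 4 := by decide
  refine ⟨fun n hn F => FaultyCube.qminus_isHamiltonian hn F,
    ⟨_, hneutral, hmass, FaultyCube.not_qminus_cubeFault_isHamiltonian⟩,
    ⟨by decide, fun n hn F => FaultyCube.qminus_isHamiltonian hn F⟩, fun m hm => ?_⟩
  by_contra! hlt
  exact FaultyCube.not_qminus_cubeFault_isHamiltonian (hm.2 3 (by omega) _ hneutral hmass)
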